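/- **Conventions.** A diffeological space is a set $X$ with a collection of maps $U\to X$ (plots), $U$ ranging over the open subsets of the spaces $\mathbb R^n$, containing the constant maps, closed under precomposition with smooth maps, and local; smooth maps are the maps which send plots to plots. $C^\infty(X,Y)$ carries the functional diffeology: $P:W\to C^\infty(X,Y)$ is a plot iff $(w,x)\mapsto P(w)(x)$ is smooth on $W\times X$. A diffeological vector space is a vector space with a diffeology for which addition and scalar multiplication are smooth; an isomorphism of such is a linear bijection smooth in both directions. A *diffeological vector pseudo-bundle* is a smooth map $\pi:E\to B$ of diffeological spaces with vector space structures on the fibres $E_b$ such that fibrewise addition $E\times_BE\to E$, scalar multiplication $\mathbb R\times E\to E$ and the zero section $B\to E$ are smooth. A bundle map is a commutative square of smooth maps that is linear on fibres; this gives the category $\mathrm{DVPB}$. The space $\Gamma(E)$ of smooth sections is a diffeological vector space with the subset diffeology from $C^\infty(B,E)$. The dual bundle $E^*\to B$ has as fibre over $b$ the smooth linear maps $E_b\to\mathbb R$, and $P:W\to E^*$ is a plot iff $W\to E^*\to B$ is smooth and $(w,e)\mapsto P(w)(e)$ is smooth on $W\times_BE$. The exterior power $\Lambda^kE\to B$ has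 fibres $\Lambda^k(E_b)$, with the smallest diffeology making it a pseudo-bundle for which the fibrewise wedge product $E\times_B\cdots\times_BE\to\Lambda^kE$ is smooth (for $k=0$ it is $B\times\mathbb R$). For a diffeological space $X$, the plot category of $X$ has as objects the plots $p:U\to X$ and as morphisms $p\to q$ (with $q:V\to X$) the smooth maps $f:U\to V$ with $q\circ f=p$. For $k\ge 0$ let $T^kX$ be the colimit in $\mathrm{DVPB}$ of the bundles $\Lambda^kTU\to U$ over the plot category of $X$; it is a pseudo-bundle over $\operatorname{colim}U=X$. A smooth map $f:X\to Y$ induces a bundle map $T^kf:T^kX\to T^kY$ over $f$, and a map $\Gamma((T^kY)^*)\to\Gamma((T^kX)^*)$, $s\mapsto \big(x\mapsto s(f(x))\circ T^k_xf\big)$. Let $\Omega^k(X)$ be the limit, as a diffeological vector space, of the spaces $\Omega^k(U)$ of smooth $k$-forms (with the functional diffeology) over the plot category of $X$: its elements are the families $\omega=(\omega_p)_p$ with $\omega_p\in\Omega^k(U)$ for each plot $p:U\to X$ and $\omega_p=f^*\omega_q$ for each morphism $f:p\to q$, and a map into it is a plot iff all its components are. For $f:X\to Y$ smooth, $f^*:\Omega^k(Y)\to\Omega^k(X)$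 is $(f^*\omega)_p=\omega_{f\circ p}$. **Theorem.** For every $k\ge0$ and every diffeological space $X$ there is an isomorphism of diffeological vector spaces $$\Phi_X:\Gamma\big((T^kX)^*\to X\big)\longrightarrow\Omega^k(X),$$ natural in $X$ with respect to all smooth maps. It satisfies $$\big(\Phi_X(s)\big)_p(u)(v_1,\dots,v_k)=s(p(u))\big([v_1\wedge\cdots\wedge v_k]\big)$$ for every section $s$, plot $p:U\to X$, $u\in U$ and $v_1,\dots,v_k\in T_uU$, where $[\,\cdot\,]$ denotes the canonical map $\Lambda^kT_uU\to T^k_{p(u)}X$. -/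

import Mathlib

open Diffeology CategoryTheory TopologicalSpace
open scoped ContDiff

universe u

namespace DForm

noncomputable section

/-! ### Diffeological preliminaries -/

/-- The Euclidean space `ℝⁿ`. -/
abbrev Euc (n : ℕ) : Type := EuclideanSpace ℝ (Fin n)

/-- The diffeology pulled back along a map `f` (for injective `f`: the subset diffeology). -/
@[reducible] def induced {X Y : Type*} (d : DiffeologicalSpace Y) (f : X → Y) :
    DiffeologicalSpace X where
  plots _ := {p | IsPlot (f ∘ p)}
  constant_plots _ := isPlot_const
  plot_reparam {_ _ p _} hp hf := isPlot_reparam (p := f ∘ p) hp hf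
  locality hp := DiffeologicalSpace.locality hp

theorem le_induced {X Y : Type*} {d₀ : DiffeologicalSpace X} {d : DiffeologicalSpace Y} {f : X → Y}
    (h : @DSmooth _ _ d₀ d f) : d₀ ≤ induced d f :=
  DiffeologicalSpace.le_iff'.2 h

theorem dSmooth_of_le_induced {X Y : Type*} {d₀ : DiffeologicalSpace X} {d : DiffeologicalSpace Y}
    {f : X → Y} (h : d₀ ≤ induced d f) : @DSmooth _ _ d₀ d f :=
  DiffeologicalSpace.le_iff'.1 h

/-- An open subset of `ℝⁿ` carries the subset diffeology. -/
instance openDiffeology {n : ℕ} (U : Opens (Euc n)) : DiffeologicalSpace U :=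
  induced inferInstance (Subtype.val : U → Euc n)

instance uliftDiffeology {X : Type*} [d : DiffeologicalSpace X] :
    DiffeologicalSpace (ULift.{u} X) := induced d ULift.down

/-- The set `C^∞(X, Y)` of smooth maps. -/
def SmoothMap (X Y : Type*) [DiffeologicalSpace X] [DiffeologicalSpace Y] : Type _ :=
  {f : X → Y // DSmooth f}

/-- The functional diffeology on `C^∞(X, Y)`: a map `P : ℝⁿ → C^∞(X, Y)` is a plot if and only if
`(w, x) ↦ P w x` is smooth on `ℝⁿ × X`; the plots of `ℝⁿ × X` are the pairs `(g, x)` below. -/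
instance functionalDiffeology (X Y : Type*) [DiffeologicalSpace X] [DiffeologicalSpace Y] :
    DiffeologicalSpace (SmoothMap X Y) where
  plots n := {P | ∀ ⦃m : ℕ⦄ (g : Euc m → Euc n) (x : Euc m → X),
    ContDiff ℝ ∞ g → IsPlot x → IsPlot (fun z => (P (g z)).1 (x z))}
  constant_plots f := fun _ _ x _ hx => f.2 _ x hx
  plot_reparam hp hf := fun _ g x hg hx => hp (_ ∘ g) x (hf.comp hg) hx
  locality {n P} hP := fun m g x hg hx => by
    refine DiffeologicalSpace.locality fun z => ?_
    obtain ⟨s, hs, hzs, H⟩ := hP (g z)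
    refine ⟨g ⁻¹' s, hs.preimage hg.continuous, hzs, fun {l f} hf hf' => ?_⟩
    exact H (f := g ∘ f) hf (hg.comp hf') id (x ∘ f) contDiff_id (isPlot_reparam hx hf')

/-- A diffeological vector space: addition and scalar multiplication are smooth. -/
class IsDiffeologicalVectorSpace (V : Type*) [AddCommGroup V] [Module ℝ V]
    [DiffeologicalSpace V] : Prop where
  smooth_add : ∀ {n : ℕ} {v w : Euc n → V}, IsPlot v → IsPlot w → IsPlot (fun z => v z + w z)
  smooth_smul : ∀ {n : ℕ} {r : Euc n → ℝ} {v : Euc n → V},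
    ContDiff ℝ ∞ r → IsPlot v → IsPlot (fun z => r z • v z)

/-- An isomorphism of diffeological vector spaces: a linear diffeomorphism. -/
structure DVSEquiv (V W : Type*)
    [AddCommGroup V] [Module ℝ V] [DiffeologicalSpace V] [IsDiffeologicalVectorSpace V]
    [AddCommGroup W] [Module ℝ W] [DiffeologicalSpace W] [IsDiffeologicalVectorSpace W] where
  toEquiv : V ≃ₗ[ℝ] W
  smooth_toFun : DSmooth (fun v => toEquiv v)
  smooth_invFun : DSmooth (fun w => toEquiv.symm w)

/-! ### Diffeological vector pseudo-bundles -/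

/-- For a family of vector spaces `F b`, indexed by the points of a diffeological space `B`, the
condition that a diffeology on the total space `Σ b, F b` makes the projection to `B` a
diffeological vector pseudo-bundle: the projection, the fibrewise addition on the fibre product, the
fibrewise scalar multiplication and the zero section are smooth. -/
structure IsPseudoBundle {B : Type*} [DiffeologicalSpace B] {F : B → Type*}
    [∀ b, AddCommGroup (F b)] [∀ b, Module ℝ (F b)] (d : DiffeologicalSpace (Σ b, F b)) :
    Prop where
  smooth_proj : DSmooth (Sigma.fst : (Σ b, F b) → B)
  smooth_add : ∀ {n : ℕ} {q : Euc n → B} {v w : ∀ z, F (q z)},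
    IsPlot (fun z => (⟨q z, v z⟩ : Σ b, F b)) → IsPlot (fun z => (⟨q z, w z⟩ : Σ b, F b)) →
      IsPlot (fun z => (⟨q z, v z + w z⟩ : Σ b, F b))
  smooth_smul : ∀ {n : ℕ} {r : Euc n → ℝ} {q : Euc n → B} {v : ∀ z, F (q z)},
    ContDiff ℝ ∞ r → IsPlot (fun z => (⟨q z, v z⟩ : Σ b, F b)) →
      IsPlot (fun z => (⟨q z, r z • v z⟩ : Σ b, F b))
  smooth_zero : DSmooth (fun b => (⟨b, 0⟩ : Σ b, F b))

/-- A diffeological vector pseudo-bundle; its total space is the disjoint union of its fibres. -/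
structure DVPB : Type (u + 1) where
  base : Type u
  fibre : base → Type u
  [baseDiff : DiffeologicalSpace base]
  [fibreAddCommGroup : ∀ b, AddCommGroup (fibre b)]
  [fibreModule : ∀ b, Module ℝ (fibre b)]
  [totalDiff : DiffeologicalSpace (Σ b, fibre b)]
  isPseudoBundle : IsPseudoBundle totalDiff

attribute [instance] DVPB.baseDiff DVPB.fibreAddCommGroup DVPB.fibreModule DVPB.totalDiff

/-- The total space. -/
abbrev DVPB.Total (E : DVPB.{u}) : Type u := Σ b, E.fibre b

/-- A bundle map: a smooth map of base spaces and a smooth map of total spaces over it which is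
linear on each fibre. -/
structure DVPB.Hom (E E' : DVPB.{u}) where
  base : E.base → E'.base
  fib : ∀ b, E.fibre b →ₗ[ℝ] E'.fibre (base b)
  smooth_base : DSmooth base
  smooth_total : DSmooth (fun x : E.Total => (⟨base x.1, fib x.1 x.2⟩ : E'.Total))

/-- The map of total spaces of a bundle map. -/
def DVPB.Hom.total {E E' : DVPB.{u}} (f : E.Hom E') (x : E.Total) : E'.Total :=
  ⟨f.base x.1, f.fib x.1 x.2⟩

theorem DVPB.Hom.ext_total {E E' : DVPB.{u}} {f g : E.Hom E'}
    (h : ∀ x, f.total x = g.total x) : f = g := by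
  obtain ⟨fb, ff, hf, hf'⟩ := f
  obtain ⟨gb, gf, hg, hg'⟩ := g
  have hb : fb = gb := funext fun b => congrArg Sigma.fst (h ⟨b, 0⟩)
  subst hb
  have hfib : ff = gf := funext fun b => LinearMap.ext fun v =>
    eq_of_heq (Sigma.mk.inj (h ⟨b, v⟩)).2
  subst hfib
  rfl

/-- The category of diffeological vector pseudo-bundles and bundle maps. -/
instance : Category.{u} DVPB.{u} where
  Hom E E' := E.Hom E'
  id E := ⟨id, fun _ => LinearMap.id, dSmooth_id, dSmooth_id⟩
  comp f g := ⟨g.base ∘ f.base, fun b => (g.fib (f.base b)).comp (f.fib b),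
    g.smooth_base.comp f.smooth_base, g.smooth_total.comp f.smooth_total⟩

theorem DVPB.hom_ext {E E' : DVPB.{u}} {f g : E ⟶ E'}
    (h : ∀ x, DVPB.Hom.total f x = DVPB.Hom.total g x) : f = g :=
  DVPB.Hom.ext_total h

section Dvsification

variable {B : Type*} [DiffeologicalSpace B] {F : B → Type*}
  [∀ b, AddCommGroup (F b)] [∀ b, Module ℝ (F b)]

/-- Dvsification: the smallest diffeology on the total space which contains the given one and which
makes the projection a diffeological vector pseudo-bundle. -/
@[reducible] def dvsification (d₀ : DiffeologicalSpace (Σ b, F b)) :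
    DiffeologicalSpace (Σ b, F b) :=
  sInf {d | d₀ ≤ d ∧ IsPseudoBundle d}

theorem le_dvsification (d₀ : DiffeologicalSpace (Σ b, F b)) : d₀ ≤ dvsification d₀ :=
  le_sInf fun _ hd => hd.1

/-- Bundle maps into a pseudo-bundle can be used to pull back pseudo-bundle diffeologies. -/
theorem isPseudoBundle_pullback (E : DVPB.{u}) (g : B → E.base) (hg : DSmooth g)
    (φ : ∀ b, F b →ₗ[ℝ] E.fibre (g b)) :
    IsPseudoBundle (induced (inferInstance : DiffeologicalSpace B) (Sigma.fst : (Σ b, F b) → B) ⊓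
      induced E.totalDiff (fun x : Σ b, F b => (⟨g x.1, φ x.1 x.2⟩ : E.Total))) := by
  constructor
  · exact fun n p hp => (DiffeologicalSpace.isPlot_inf_iff.1 hp).1
  · intro n q v w hv hw
    rw [DiffeologicalSpace.isPlot_inf_iff] at *
    refine ⟨hv.1, ?_⟩
    have := E.isPseudoBundle.smooth_add (q := g ∘ q) (v := fun z => φ _ (v z))
      (w := fun z => φ _ (w z)) hv.2 hw.2
    simp only [← map_add] at this
    exact this
  · intro n r q v hr hv
    rw [DiffeologicalSpace.isPlot_inf_iff] at *
    refine ⟨hv.1, ?_⟩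
    have := E.isPseudoBundle.smooth_smul (q := g ∘ q) (v := fun z => φ _ (v z)) hr hv.2
    simp only [← map_smul] at this
    exact this
  · intro n p hp
    rw [DiffeologicalSpace.isPlot_inf_iff]
    refine ⟨hp, ?_⟩
    have := (E.isPseudoBundle.smooth_zero.comp hg) n p hp
    have h2 : (fun x : Σ b, F b => (⟨g x.1, φ x.1 x.2⟩ : E.Total)) ∘
        ((fun b => (⟨b, 0⟩ : Σ b, F b)) ∘ p) =
        ((fun b => (⟨b, 0⟩ : E.Total)) ∘ g) ∘ p := by
      funext z; simp
    change IsPlot ((fun x : Σ b, F b => (⟨g x.1, φ x.1 x.2⟩ : E.Total)) ∘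
        ((fun b => (⟨b, 0⟩ : Σ b, F b)) ∘ p))
    rw [h2]
    exact this

/-- The diffeology with all lifts of plots of the base makes the projection a pseudo-bundle. -/
theorem isPseudoBundle_coarse :
    IsPseudoBundle (induced (inferInstance : DiffeologicalSpace B)
      (Sigma.fst : (Σ b, F b) → B)) :=
  ⟨fun _ _ hp => hp, fun hv _ => hv, fun _ hv => hv, fun _ _ hp => hp⟩

/-- Dvsification produces a pseudo-bundle. -/
theorem isPseudoBundle_dvsification (d₀ : DiffeologicalSpace (Σ b, F b))
    (h₀ : DSmooth (Sigma.fst : (Σ b, F b) → B)) : IsPseudoBundle (dvsification d₀) := by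
  constructor
  · intro n p hp
    exact DiffeologicalSpace.isPlot_sInf_iff.1 hp _
      ⟨le_induced h₀, isPseudoBundle_coarse⟩
  · intro n q v w hv hw
    rw [DiffeologicalSpace.isPlot_sInf_iff] at *
    exact fun d hd => hd.2.smooth_add (hv d hd) (hw d hd)
  · intro n r q v hr hv
    rw [DiffeologicalSpace.isPlot_sInf_iff] at *
    exact fun d hd => hd.2.smooth_smul hr (hv d hd)
  · intro n p hp
    rw [DiffeologicalSpace.isPlot_sInf_iff]
    exact fun d hd => hd.2.smooth_zero n p hp

/-- A fibrewise linear map to a pseudo-bundle which is smooth before dvsification is smooth. -/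
theorem dvsification_desc (d₀ : DiffeologicalSpace (Σ b, F b))
    (h₀ : DSmooth (Sigma.fst : (Σ b, F b) → B))
    (E : DVPB.{u}) (g : B → E.base) (hg : DSmooth g) (φ : ∀ b, F b →ₗ[ℝ] E.fibre (g b))
    (h : @DSmooth _ _ d₀ _ (fun x : Σ b, F b => (⟨g x.1, φ x.1 x.2⟩ : E.Total))) :
    @DSmooth _ _ (dvsification d₀) _
      (fun x : Σ b, F b => (⟨g x.1, φ x.1 x.2⟩ : E.Total)) := by
  intro n p hp
  exact (DiffeologicalSpace.isPlot_inf_iff.1 (DiffeologicalSpace.isPlot_sInf_iff.1 hp _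
    ⟨le_inf (le_induced h₀) (le_induced h), isPseudoBundle_pullback E g hg φ⟩)).2

end Dvsification

/-! ### Exterior powers -/

/-- The smallest diffeology on `Σ b, ⋀ᵏ E_b` for which the fibrewise wedge product
`E ×_B ⋯ ×_B E → Σ b, ⋀ᵏ E_b` is smooth. The plots of the `k`-fold fibre product are the tuples of
plots `v · i` of `E` over a common plot `q` of `B`. -/
@[reducible] def wedgeDiffeology (k : ℕ) (E : DVPB.{u}) :
    DiffeologicalSpace (Σ b, ⋀[ℝ]^k (E.fibre b)) :=
  DiffeologicalSpace.generateFrom {P | ∃ (n : ℕ) (q : Euc n → E.base)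
    (v : ∀ z, Fin k → E.fibre (q z)),
    IsPlot q ∧ (∀ i, IsPlot (fun z => (⟨q z, v z i⟩ : E.Total))) ∧
    P = ⟨n, fun z => ⟨q z, exteriorPower.ιMulti ℝ k (v z)⟩⟩}

theorem wedgeDiffeology_proj (k : ℕ) (E : DVPB.{u}) :
    @DSmooth _ _ (wedgeDiffeology k E) _ (Sigma.fst : (Σ b, ⋀[ℝ]^k (E.fibre b)) → E.base) := by
  have : wedgeDiffeology k E ≤ induced E.baseDiff Sigma.fst := by
    rw [DiffeologicalSpace.generateFrom_le_iff]
    rintro _ _ ⟨n, q, v, hq, -, h⟩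
    cases h
    exact hq
  exact dSmooth_of_le_induced this

/-- The exterior power bundle: the fibres are the exterior powers of the fibres, and the plots are
locally the finite linear combinations of wedge products of compatible plots. -/
def DVPB.exteriorPower (k : ℕ) (E : DVPB.{u}) : DVPB.{u} where
  base := E.base
  fibre b := ⋀[ℝ]^k (E.fibre b)
  totalDiff := dvsification (wedgeDiffeology k E)
  isPseudoBundle := isPseudoBundle_dvsification _ (wedgeDiffeology_proj k E)

/-- The `k`-fold exterior power functor. -/
def exteriorPowerFunctor (k : ℕ) : DVPB.{u} ⥤ DVPB.{u} where
  obj E := E.exteriorPower k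
  map {E E'} f :=
    { base := f.base
      fib := fun (b : E.base) => exteriorPower.map k (f.fib b)
      smooth_base := f.smooth_base
      smooth_total := by
        refine dvsification_desc (wedgeDiffeology k E) (wedgeDiffeology_proj k E)
          (E'.exteriorPower k) f.base f.smooth_base (fun b => exteriorPower.map k (f.fib b)) ?_
        have : wedgeDiffeology k E ≤ induced (E'.exteriorPower k).totalDiff
            (fun x : Σ b, ⋀[ℝ]^k (E.fibre b) =>
              (⟨f.base x.1, exteriorPower.map k (f.fib x.1) x.2⟩ :
                Σ b, ⋀[ℝ]^k (E'.fibre b))) := by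
          rw [DiffeologicalSpace.generateFrom_le_iff]
          rintro _ _ ⟨n, q, v, hq, hv, h⟩
          cases h
          refine DiffeologicalSpace.le_iff'.1 (le_dvsification (wedgeDiffeology k E')) _ _
            (DiffeologicalSpace.isPlot_generatedFrom_of_mem
              ⟨_, f.base ∘ q, fun z i => f.fib _ (v z i), f.smooth_base _ _ hq,
                fun i => f.smooth_total _ _ (hv i), ?_⟩)
          refine congrArg (Sigma.mk _) (funext fun z => ?_)
          exact congrArg (Sigma.mk _) (exteriorPower.map_apply_ιMulti _ _)
        exact dSmooth_of_le_induced this }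
  map_id E := DVPB.hom_ext fun (x : Σ b, ⋀[ℝ]^k (E.fibre b)) => by
    change (⟨x.1, exteriorPower.map k LinearMap.id x.2⟩ : Σ b, ⋀[ℝ]^k (E.fibre b)) = x
    rw [exteriorPower.map_id]; rfl
  map_comp {E E' E''} f g := DVPB.hom_ext fun (x : Σ b, ⋀[ℝ]^k (E.fibre b)) => by
    change (⟨g.base (f.base x.1), exteriorPower.map k ((g.fib _).comp (f.fib x.1)) x.2⟩ :
      Σ b, ⋀[ℝ]^k (E''.fibre b)) = ⟨g.base (f.base x.1),
        exteriorPower.map k (g.fib _) (exteriorPower.map k (f.fib x.1) x.2)⟩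
    rw [exteriorPower.map_comp]; rfl

/-! ### Sections and duals -/

/-- The space `Γ(E)` of smooth sections of a pseudo-bundle. -/
def DVPB.sections (E : DVPB.{u}) : Submodule ℝ (∀ b, E.fibre b) where
  carrier := {s | DSmooth (fun b => (⟨b, s b⟩ : E.Total))}
  zero_mem' := E.isPseudoBundle.smooth_zero
  add_mem' hs ht := fun n p hp => E.isPseudoBundle.smooth_add (hs n p hp) (ht n p hp)
  smul_mem' c _ hs := fun n p hp =>
    E.isPseudoBundle.smooth_smul (r := fun _ => c) contDiff_const (hs n p hp)

/-- A section as a smooth map from the base to the total space. -/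
def DVPB.sectionMap (E : DVPB.{u}) (s : E.sections) : SmoothMap E.base E.Total :=
  ⟨fun b => ⟨b, s.1 b⟩, s.2⟩

/-- The subset diffeology on `Γ(E)` from `C^∞(B, E)`. -/
instance sectionsDiffeology (E : DVPB.{u}) : DiffeologicalSpace E.sections :=
  induced (functionalDiffeology _ _) E.sectionMap

instance (E : DVPB.{u}) : IsDiffeologicalVectorSpace E.sections where
  smooth_add hv hw := fun _ g x hg hx =>
    E.isPseudoBundle.smooth_add (hv g x hg hx) (hw g x hg hx)
  smooth_smul hr hv := fun _ g x hg hx =>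
    E.isPseudoBundle.smooth_smul (hr.comp hg) (hv g x hg hx)

/-- The smooth dual of the fibre at `b`: the linear maps `E_b → ℝ` which are smooth for the subset
diffeology of `E_b` in the total space. -/
def DVPB.smoothDual (E : DVPB.{u}) (b : E.base) : Submodule ℝ (E.fibre b →ₗ[ℝ] ℝ) where
  carrier := {φ | @DSmooth _ _ (induced E.totalDiff (Sigma.mk b)) _ φ}
  zero_mem' := fun _ _ _ => isPlot_const
  add_mem' hs ht := fun n p hp => ((hs n p hp).contDiff.add (ht n p hp).contDiff).isPlot
  smul_mem' c _ hs := fun n p hp => ((hs n p hp).contDiff.const_smul c).isPlot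

/-- The diffeology of the dual bundle: `P : ℝⁿ → E*` is a plot if and only if its composite with
the projection is a plot and `(w, x) ↦ P w x` is smooth on the fibre product `ℝⁿ ×_B E`. -/
@[reducible] def dualDiffeology (E : DVPB.{u}) : DiffeologicalSpace (Σ b, E.smoothDual b) where
  plots n := {P | IsPlot (fun z => (P z).1) ∧
    ∀ ⦃m : ℕ⦄ (g : Euc m → Euc n) (x : ∀ z, E.fibre (P (g z)).1), ContDiff ℝ ∞ g →
      IsPlot (fun z => (⟨(P (g z)).1, x z⟩ : E.Total)) →
      ContDiff ℝ ∞ (fun z => (P (g z)).2.1 (x z))}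
  constant_plots φ := ⟨isPlot_const, fun _ _ x _ hx => (φ.2.2 _ x hx).contDiff⟩
  plot_reparam hp hf := ⟨isPlot_reparam hp.1 hf, fun _ g x hg hx => hp.2 (_ ∘ g) x (hf.comp hg) hx⟩
  locality {n P} hP := by
    refine ⟨DiffeologicalSpace.locality fun z => ?_, fun m g x hg hx => IsPlot.contDiff ?_⟩
    · obtain ⟨s, hs, hzs, H⟩ := hP z
      exact ⟨s, hs, hzs, fun {l f} hf hf' => (H hf hf').1⟩
    · refine DiffeologicalSpace.locality fun z => ?_
      obtain ⟨s, hs, hzs, H⟩ := hP (g z)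
      refine ⟨g ⁻¹' s, hs.preimage hg.continuous, hzs, fun {l f} hf hf' => ContDiff.isPlot ?_⟩
      exact (H (f := g ∘ f) hf (hg.comp hf')).2 id (fun z => x (f z)) contDiff_id
        (isPlot_reparam hx hf')

/-- The dual bundle `E* = Hom_B(E, B × ℝ)`. -/
def DVPB.dual (E : DVPB.{u}) : DVPB.{u} where
  base := E.base
  fibre b := E.smoothDual b
  totalDiff := dualDiffeology E
  isPseudoBundle :=
    { smooth_proj := fun _ _ hp => hp.1
      smooth_add := fun hv hw => ⟨hv.1, fun _ g x hg hx => (hv.2 g x hg hx).add (hw.2 g x hg hx)⟩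
      smooth_smul := fun hr hv => ⟨hv.1, fun _ g x hg hx => (hr.comp hg).mul (hv.2 g x hg hx)⟩
      smooth_zero := fun _ _ hp => ⟨hp, fun _ _ _ _ _ => contDiff_const⟩ }

/-- A bundle map `f : E ⟶ E'` over `g` pulls back sections of the dual of `E'` to sections of the
dual of `E`, by `(f^* s)(b) = s(g b) ∘ f_b`. -/
def DVPB.pullDual {E E' : DVPB.{u}} (f : E ⟶ E') (s : E'.dual.sections) : E.dual.sections :=
  ⟨fun (b : E.base) => ⟨(s.1 (f.base b)).1.comp (f.fib b), fun n p hp =>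
      (s.1 (f.base b)).2 n (fun z => f.fib b (p z)) (f.smooth_total n _ hp)⟩,
    fun n p hp => ⟨hp, fun _ g x hg hx =>
      (s.2 n (fun z => f.base (p z)) (f.smooth_base n p hp)).2 g (fun z => f.fib _ (x z)) hg
        (f.smooth_total _ _ hx)⟩⟩

/-! ### Colimits of pseudo-bundles -/

section Colimit

variable {J : Type u} [Category.{0} J] (F : J ⥤ DVPB.{u}) {B : Type u} [DiffeologicalSpace B]

/-- A cocone of smooth maps on the base spaces of a diagram of pseudo-bundles. -/
structure BaseCocone (F : J ⥤ DVPB.{u}) (B : Type u) [DiffeologicalSpace B] where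
  leg : ∀ j, (F.obj j).base → B
  smooth : ∀ j, DSmooth (leg j)
  comm : ∀ {i j : J} (f : i ⟶ j) (a : (F.obj i).base), leg j ((F.map f).base a) = leg i a

variable {F} (c : BaseCocone F B)

/-- The points of the base spaces of the diagram lying over `b`. -/
structure PointOver (b : B) : Type u where
  idx : J
  pt : (F.obj idx).base
  isOver : c.leg idx pt = b

/-- The fibre of the diagram at a point over `b`. -/
abbrev fibreOver {b : B} (a : PointOver c b) : Type u := (F.obj a.idx).fibre a.pt

open Classical in
/-- The relations `v ∼ f_* v` defining the colimit of the fibres over `b`. -/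
def colimitRelations (b : B) : Submodule ℝ (DirectSum (PointOver c b) (fibreOver c)) :=
  Submodule.span ℝ {e | ∃ (i j : J) (f : i ⟶ j) (a : (F.obj i).base) (h : c.leg i a = b)
    (v : (F.obj i).fibre a),
    e = DirectSum.lof ℝ (PointOver c b) (fibreOver c)
        ⟨j, (F.map f).base a, (c.comm f a).trans h⟩ ((F.map f).fib a v) -
      DirectSum.lof ℝ (PointOver c b) (fibreOver c) ⟨i, a, h⟩ v}

/-- The colimit, in vector spaces, of the fibres over `b`. -/
abbrev ColimitFibre (b : B) : Type u :=
  DirectSum (PointOver c b) (fibreOver c) ⧸ colimitRelations c b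

open Classical in
/-- The canonical map from a fibre of the diagram to the colimit. -/
def toColimitFibre {b : B} (a : PointOver c b) : fibreOver c a →ₗ[ℝ] ColimitFibre c b :=
  (colimitRelations c b).mkQ.comp (DirectSum.lof ℝ (PointOver c b) (fibreOver c) a)

/-- The canonical map from the total spaces of the diagram to the total space of the colimit. -/
def toColimitTotal (j : J) (x : (F.obj j).Total) : Σ b, ColimitFibre c b :=
  ⟨c.leg j x.1, toColimitFibre c ⟨j, x.1, rfl⟩ x.2⟩

/-- The smallest diffeology for which all the canonical maps are smooth. -/
@[reducible] def colimitPreDiffeology : DiffeologicalSpace (Σ b, ColimitFibre c b) :=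
  DiffeologicalSpace.generateFrom {P | ∃ (n : ℕ) (j : J) (q : Euc n → (F.obj j).Total),
    IsPlot q ∧ P = ⟨n, fun z => toColimitTotal c j (q z)⟩}

theorem colimitPreDiffeology_proj :
    @DSmooth _ _ (colimitPreDiffeology c) _ (Sigma.fst : (Σ b, ColimitFibre c b) → B) := by
  have : colimitPreDiffeology c ≤ induced inferInstance Sigma.fst := by
    rw [DiffeologicalSpace.generateFrom_le_iff]
    rintro _ _ ⟨n, j, q, hq, h⟩
    cases h
    exact c.smooth j _ _ ((F.obj j).isPseudoBundle.smooth_proj _ _ hq)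
  exact dSmooth_of_le_induced this

/-- The bundle over `B` whose fibres are the colimits of the fibres of the diagram. When `B` is the
colimit of the base spaces, this is the colimit of the diagram, see `colimitIsColimit`. -/
def colimitBundle : DVPB.{u} where
  base := B
  fibre := ColimitFibre c
  totalDiff := dvsification (colimitPreDiffeology c)
  isPseudoBundle := isPseudoBundle_dvsification _ (colimitPreDiffeology_proj c)

/-- The canonical bundle map from an object of the diagram. -/
def colimitLeg (j : J) : F.obj j ⟶ colimitBundle c where
  base := c.leg j
  fib a := toColimitFibre c ⟨j, a, rfl⟩
  smooth_base := c.smooth j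
  smooth_total := fun _ q hq => DiffeologicalSpace.le_iff'.1 (le_dvsification (colimitPreDiffeology c)) _ _
    (DiffeologicalSpace.isPlot_generatedFrom_of_mem ⟨_, j, q, hq, rfl⟩)

theorem toColimitFibre_rfl {b : B} (j : J) (a : (F.obj j).base) (h : c.leg j a = b)
    (v : (F.obj j).fibre a) :
    (⟨c.leg j a, toColimitFibre c ⟨j, a, rfl⟩ v⟩ : Σ b, ColimitFibre c b) =
      ⟨b, toColimitFibre c ⟨j, a, h⟩ v⟩ := by
  subst h; rfl

theorem toColimitFibre_map {b : B} {i j : J} (f : i ⟶ j) (a : (F.obj i).base) (h : c.leg i a = b)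
    (v : (F.obj i).fibre a) :
    toColimitFibre c ⟨j, (F.map f).base a, (c.comm f a).trans h⟩ ((F.map f).fib a v) =
      toColimitFibre c ⟨i, a, h⟩ v :=
  (Submodule.Quotient.eq _).2 (Submodule.subset_span ⟨i, j, f, a, h, v, rfl⟩)

/-- The cocone of bundle maps to `colimitBundle`. -/
def colimitCocone : Limits.Cocone F where
  pt := colimitBundle c
  ι :=
    { app := colimitLeg c
      naturality := fun i j f => DVPB.hom_ext fun x => by
        change (⟨c.leg j _, toColimitFibre c ⟨j, (F.map f).base x.1, rfl⟩
          ((F.map f).fib x.1 x.2)⟩ : Σ b, ColimitFibre c b) =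
          ⟨c.leg i x.1, toColimitFibre c ⟨i, x.1, rfl⟩ x.2⟩
        exact (toColimitFibre_rfl c j _ (c.comm f x.1) _).trans
          (congrArg (Sigma.mk _) (toColimitFibre_map c f x.1 rfl x.2)) }

/-- Transport between equal fibres. -/
def fibreCast (E : DVPB.{u}) {b b' : E.base} (h : b = b') : E.fibre b →ₗ[ℝ] E.fibre b' :=
  h ▸ LinearMap.id

theorem mk_fibreCast (E : DVPB.{u}) {b b' : E.base} (h : b = b') (v : E.fibre b) :
    (⟨b', fibreCast E h v⟩ : E.Total) = ⟨b, v⟩ := by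
  subst h; rfl

theorem fibreCast_eq_iff (E : DVPB.{u}) {a a' b : E.base} (h : a = b) (h' : a' = b)
    (v : E.fibre a) (v' : E.fibre a') (e : (⟨a, v⟩ : E.Total) = ⟨a', v'⟩) :
    fibreCast E h v = fibreCast E h' v' := by
  subst h; cases e; rfl

/-- The condition that `B` is the colimit of the base spaces in diffeological spaces. -/
def BaseCocone.IsColimit : Prop :=
  ∀ (Y : Type u) [DiffeologicalSpace Y] (g : ∀ j, (F.obj j).base → Y), (∀ j, DSmooth (g j)) →
    (∀ {i j : J} (f : i ⟶ j) (a : (F.obj i).base), g j ((F.map f).base a) = g i a) →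
    ∃! h : B → Y, DSmooth h ∧ ∀ j a, h (c.leg j a) = g j a

open Classical in
/-- The fibre maps out of the colimit induced by a cocone. -/
def colimitDescFib (s : Limits.Cocone F) (h : B → s.pt.base)
    (hh : ∀ j a, h (c.leg j a) = (s.ι.app j).base a) (b : B) :
    ColimitFibre c b →ₗ[ℝ] s.pt.fibre (h b) :=
  (colimitRelations c b).liftQ
    (DirectSum.toModule ℝ _ _ fun a =>
      (fibreCast s.pt (by rw [← hh, a.isOver])).comp ((s.ι.app a.idx).fib a.pt)) (by
    rw [colimitRelations, Submodule.span_le]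
    rintro _ ⟨i, j, f, a, hb, v, rfl⟩
    simp only [SetLike.mem_coe, LinearMap.mem_ker, map_sub, DirectSum.toModule_lof,
      LinearMap.comp_apply, sub_eq_zero]
    apply fibreCast_eq_iff
    have := s.w f
    exact congrArg (fun k : F.obj i ⟶ s.pt => DVPB.Hom.total k ⟨a, v⟩) this)

theorem colimitDescFib_toColimitFibre (s : Limits.Cocone F) (h : B → s.pt.base)
    (hh : ∀ j a, h (c.leg j a) = (s.ι.app j).base a) (j : J) (x : (F.obj j).Total) :
    (⟨h (c.leg j x.1), colimitDescFib c s h hh _ (toColimitFibre c ⟨j, x.1, rfl⟩ x.2)⟩ :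
      s.pt.Total) = DVPB.Hom.total (s.ι.app j) x := by
  have : colimitDescFib c s h hh _ (toColimitFibre c ⟨j, x.1, rfl⟩ x.2) =
      fibreCast s.pt (hh j x.1).symm ((s.ι.app j).fib x.1 x.2) := by
    simp only [colimitDescFib, toColimitFibre, LinearMap.comp_apply, Submodule.mkQ_apply,
      Submodule.liftQ_apply, DirectSum.toModule_lof]
  rw [this, mk_fibreCast]
  rfl

/-- The bundle map out of the colimit induced by a cocone. -/
def colimitDesc (s : Limits.Cocone F) (h : B → s.pt.base) (hs : DSmooth h)
    (hh : ∀ j a, h (c.leg j a) = (s.ι.app j).base a) : colimitBundle c ⟶ s.pt where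
  base := h
  fib := colimitDescFib c s h hh
  smooth_base := hs
  smooth_total := by
    refine dvsification_desc (colimitPreDiffeology c) (colimitPreDiffeology_proj c) s.pt h hs
      (colimitDescFib c s h hh) ?_
    have : colimitPreDiffeology c ≤ induced s.pt.totalDiff
        (fun x : Σ b, ColimitFibre c b => ⟨h x.1, colimitDescFib c s h hh x.1 x.2⟩) := by
      rw [DiffeologicalSpace.generateFrom_le_iff]
      rintro _ _ ⟨n, j, q, hq, h⟩
      cases h
      have := (s.ι.app j).smooth_total _ q hq
      refine (congrArg (@IsPlot _ s.pt.totalDiff _) (funext fun z => ?_)).mp this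
      exact (colimitDescFib_toColimitFibre c s h hh j (q z)).symm
    exact dSmooth_of_le_induced this

theorem colimitDesc_uniq (s : Limits.Cocone F) (m : colimitBundle c ⟶ s.pt)
    (hm : ∀ j, colimitLeg c j ≫ m = s.ι.app j) (h : B → s.pt.base) (hs : DSmooth h)
    (hh : ∀ j a, h (c.leg j a) = (s.ι.app j).base a) (hb : h = m.base) :
    m = colimitDesc c s h hs hh := by
  classical
  subst hb
  refine DVPB.hom_ext fun x => ?_
  obtain ⟨b, e⟩ := x
  have key : m.fib b = colimitDescFib c s m.base hh b := by
    refine Submodule.linearMap_qext _ (DirectSum.linearMap_ext _ ?_)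
    rintro ⟨j, a, rfl⟩
    ext v
    have h1 : DVPB.Hom.total m (toColimitTotal c j ⟨a, v⟩) = DVPB.Hom.total (s.ι.app j) ⟨a, v⟩ :=
      congrArg (fun k : F.obj j ⟶ s.pt => DVPB.Hom.total k ⟨a, v⟩) (hm j)
    rw [← colimitDescFib_toColimitFibre c s m.base hh j ⟨a, v⟩] at h1
    exact eq_of_heq (Sigma.mk.inj h1).2
  exact congrArg (fun y => (⟨m.base b, y⟩ : s.pt.Total)) (LinearMap.congr_fun key e)

/-- Over the colimit of the base spaces, `colimitBundle` is the colimit in the category of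
diffeological vector pseudo-bundles. -/
def colimitIsColimit (hc : c.IsColimit) : Limits.IsColimit (colimitCocone c) :=
  have H := fun s : Limits.Cocone F => hc s.pt.base (fun j => (s.ι.app j).base)
    (fun j => (s.ι.app j).smooth_base)
    (fun {i j} f a => congrArg (fun k : F.obj i ⟶ s.pt => k.base a) (s.w f))
  { desc := fun s => colimitDesc c s (H s).choose (H s).choose_spec.1.1 (H s).choose_spec.1.2
    fac := fun s j => DVPB.hom_ext fun x =>
      colimitDescFib_toColimitFibre c s _ (H s).choose_spec.1.2 j x
    uniq := fun s m hm => by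
      have hb : m.base = (H s).choose := (H s).choose_spec.2 m.base
        ⟨m.smooth_base, fun j a => congrArg (fun k : F.obj j ⟶ s.pt => k.base a) (hm j)⟩
      exact colimitDesc_uniq c s m hm _ _ _ hb.symm }

end Colimit

/-! ### The plot category and its tangent bundles -/

/-- A plot `U → X` defined on an open subset `U` of some `ℝⁿ`. -/
structure PlotCat (X : Type u) [DiffeologicalSpace X] : Type u where
  dim : ℕ
  dom : Opens (Euc dim)
  toFun : dom → X
  smooth : DSmooth toFun

/-- The extension by zero to `ℝⁿ` of a map between open subsets. Smoothness and the derivative at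
points of the open subset `U` are expressed through it. -/
def openExt {n m : ℕ} {U : Opens (Euc n)} {V : Opens (Euc m)} (f : U → V) : Euc n → Euc m :=
  Function.extend Subtype.val (fun x => (f x : Euc m)) 0

/-- The derivative `T_u U → T_{f u} V` of a map between open subsets. -/
def openDeriv {n m : ℕ} {U : Opens (Euc n)} {V : Opens (Euc m)} (f : U → V) (x : U) :
    Euc n →L[ℝ] Euc m := fderiv ℝ (openExt f) x

theorem openExt_apply {n m : ℕ} {U : Opens (Euc n)} {V : Opens (Euc m)} (f : U → V) (x : U) :
    openExt f x = f x := Subtype.val_injective.extend_apply _ _ x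

theorem openExt_id {n : ℕ} {U : Opens (Euc n)} (x : U) :
    openExt (id : U → U) =ᶠ[nhds (x : Euc n)] id := by
  filter_upwards [U.isOpen.mem_nhds x.2] with y hy
  exact openExt_apply id ⟨y, hy⟩

theorem openExt_comp {n m l : ℕ} {U : Opens (Euc n)} {V : Opens (Euc m)} {W : Opens (Euc l)}
    (g : V → W) (f : U → V) (x : U) :
    openExt (g ∘ f) =ᶠ[nhds (x : Euc n)] openExt g ∘ openExt f := by
  filter_upwards [U.isOpen.mem_nhds x.2] with y hy
  rw [Function.comp_apply, openExt_apply (g ∘ f) ⟨y, hy⟩, openExt_apply f ⟨y, hy⟩, openExt_apply g]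
  rfl

/-- A morphism of plots: a smooth map of the domains which commutes with the maps to `X`. -/
@[ext] structure PlotCat.Hom {X : Type u} [DiffeologicalSpace X] (p q : PlotCat X) where
  toFun : p.dom → q.dom
  smooth : ∀ x : p.dom, ContDiffAt ℝ ∞ (openExt toFun) x
  comm : ∀ x, q.toFun (toFun x) = p.toFun x

/-- The plot category of `X`. -/
instance (X : Type u) [DiffeologicalSpace X] : Category.{0} (PlotCat X) where
  Hom p q := p.Hom q
  id p := ⟨id, fun x => contDiffAt_id.congr_of_eventuallyEq (openExt_id x), fun _ => rfl⟩
  comp f g := ⟨g.toFun ∘ f.toFun, fun x =>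
    ((show ContDiffAt ℝ ∞ (openExt g.toFun) (openExt f.toFun x) by
      rw [openExt_apply]; exact g.smooth _).comp _ (f.smooth x)).congr_of_eventuallyEq
        (openExt_comp _ _ x), fun x => (g.comm _).trans (f.comm x)⟩

section Tangent

variable {X : Type u} [DiffeologicalSpace X]

/-- The usual tangent bundle `TU = U × ℝⁿ → U` of the domain of a plot. -/
def tangentBundle (p : PlotCat X) : DVPB.{u} where
  base := ULift.{u} p.dom
  fibre _ := ULift.{u} (Euc p.dim)
  totalDiff := induced inferInstance (fun x => x.1) ⊓ induced inferInstance (fun x => x.2)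
  isPseudoBundle := by
    constructor
    · exact fun n q hq => (DiffeologicalSpace.isPlot_inf_iff.1 hq).1
    · intro n q v w hv hw
      rw [DiffeologicalSpace.isPlot_inf_iff] at *
      have hv' : ContDiff ℝ ∞ (fun z => (v z).down) := IsPlot.contDiff (X := Euc p.dim) hv.2
      have hw' : ContDiff ℝ ∞ (fun z => (w z).down) := IsPlot.contDiff (X := Euc p.dim) hw.2
      exact ⟨hv.1, (hv'.add hw').isPlot⟩
    · intro n r q v hr hv
      rw [DiffeologicalSpace.isPlot_inf_iff] at *
      have hv' : ContDiff ℝ ∞ (fun z => (v z).down) := IsPlot.contDiff (X := Euc p.dim) hv.2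
      exact ⟨hv.1, (hr.smul hv').isPlot⟩
    · intro n q hq
      exact DiffeologicalSpace.isPlot_inf_iff.2
        ⟨hq, isPlot_const (X := Euc p.dim) (x := 0)⟩

theorem tangentMap_aux {p q : PlotCat X} (f : p ⟶ q) {n : ℕ} (a : Euc n → p.dom)
    (ha : ContDiff ℝ ∞ (fun z => (a z : Euc p.dim))) :
    ContDiff ℝ ∞ (fun z => (f.toFun (a z) : Euc q.dim)) := by
  have : (fun z => (f.toFun (a z) : Euc q.dim)) = fun z => openExt f.toFun (a z) :=
    funext fun z => (openExt_apply _ _).symm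
  rw [this]
  exact contDiff_iff_contDiffAt.2 fun z => (f.smooth (a z)).comp z ha.contDiffAt

theorem tangentMap_aux' {p q : PlotCat X} (f : p ⟶ q) {n : ℕ} (a : Euc n → p.dom)
    (v : Euc n → Euc p.dim) (ha : ContDiff ℝ ∞ (fun z => (a z : Euc p.dim)))
    (hv : ContDiff ℝ ∞ v) : ContDiff ℝ ∞ (fun z => openDeriv f.toFun (a z) (v z)) :=
  contDiff_iff_contDiffAt.2 fun z =>
    (((f.smooth (a z)).fderiv_right (m := ∞) (by simp)).comp z ha.contDiffAt).clm_apply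
      hv.contDiffAt

/-- The tangent map of a morphism of plots. -/
def tangentMap {p q : PlotCat X} (f : p ⟶ q) : tangentBundle p ⟶ tangentBundle q where
  base := fun (b : ULift.{u} p.dom) => (⟨f.toFun b.down⟩ : ULift.{u} q.dom)
  fib := fun (b : ULift.{u} p.dom) =>
    show ULift.{u} (Euc p.dim) →ₗ[ℝ] ULift.{u} (Euc q.dim) from
    { toFun := fun v => ⟨openDeriv f.toFun b.down v.down⟩
      map_add' := fun v w => congrArg ULift.up (map_add (openDeriv f.toFun b.down) _ _)
      map_smul' := fun r v => congrArg ULift.up (map_smul (openDeriv f.toFun b.down) _ _) }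
  smooth_base := fun n a ha => by
    have ha' : ContDiff ℝ ∞ (fun z => ((a z).down : Euc p.dim)) :=
      IsPlot.contDiff (X := Euc p.dim) ha
    exact ContDiff.isPlot (X := Euc q.dim) (tangentMap_aux f _ ha')
  smooth_total := fun n P hP => by
    have hP' := DiffeologicalSpace.isPlot_inf_iff.1 hP
    have ha : ContDiff ℝ ∞ (fun z => ((P z).1.down : Euc p.dim)) :=
      IsPlot.contDiff (X := Euc p.dim) hP'.1
    have hv : ContDiff ℝ ∞ (fun z => ((P z).2.down : Euc p.dim)) :=
      IsPlot.contDiff (X := Euc p.dim) hP'.2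
    exact DiffeologicalSpace.isPlot_inf_iff.2
      ⟨ContDiff.isPlot (X := Euc q.dim) (tangentMap_aux f _ ha),
        ContDiff.isPlot (X := Euc q.dim) (tangentMap_aux' f _ _ ha hv)⟩

/-- The functor sending a plot `U → X` to the tangent bundle `TU → U`. -/
def tangentFunctor (X : Type u) [DiffeologicalSpace X] : PlotCat X ⥤ DVPB.{u} where
  obj := tangentBundle
  map := tangentMap
  map_id p := DVPB.hom_ext fun (x : Σ _ : ULift.{u} p.dom, ULift.{u} (Euc p.dim)) => by
    change (⟨x.1, ⟨openDeriv (id : p.dom → p.dom) x.1.down x.2.down⟩⟩ :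
      Σ _ : ULift.{u} p.dom, ULift.{u} (Euc p.dim)) = x
    rw [openDeriv, (openExt_id x.1.down).fderiv_eq, fderiv_id]
    rfl
  map_comp {p q r} f g :=
    DVPB.hom_ext fun (x : Σ _ : ULift.{u} p.dom, ULift.{u} (Euc p.dim)) => by
      change (⟨⟨g.toFun (f.toFun x.1.down)⟩,
          ⟨openDeriv (g.toFun ∘ f.toFun) x.1.down x.2.down⟩⟩ :
        Σ _ : ULift.{u} r.dom, ULift.{u} (Euc r.dim)) = ⟨⟨g.toFun (f.toFun x.1.down)⟩,
          ⟨openDeriv g.toFun (f.toFun x.1.down) (openDeriv f.toFun x.1.down x.2.down)⟩⟩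
      have hg : DifferentiableAt ℝ (openExt g.toFun) (openExt f.toFun x.1.down) := by
        rw [openExt_apply]
        exact (g.smooth _).differentiableAt (by simp)
      have hf := (f.smooth x.1.down).differentiableAt (by simp)
      rw [openDeriv, (openExt_comp g.toFun f.toFun x.1.down).fderiv_eq, fderiv_comp _ hg hf,
        openExt_apply]
      rfl

end Tangent

/-! ### The bundle `T^k X` -/

section Tk

variable (k : ℕ) {X Y : Type u} [DiffeologicalSpace X] [DiffeologicalSpace Y]

/-- The diagram of the bundles `⋀ᵏ TU → U` indexed by the plot category of `X`. -/
def wedgeTangentFunctor (X : Type u) [DiffeologicalSpace X] : PlotCat X ⥤ DVPB.{u} :=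
  tangentFunctor X ⋙ exteriorPowerFunctor k

/-- The cocone of base spaces given by the plots `U → X`. -/
def plotCocone (X : Type u) [DiffeologicalSpace X] : BaseCocone (wedgeTangentFunctor k X) X where
  leg p := fun (x : ULift.{u} p.dom) => p.toFun x.down
  smooth p := fun n a ha => p.smooth n (fun z => (a z).down) ha
  comm f x := f.comm x.down

/-- `X` is the colimit of the domains of its plots. -/
theorem plotCocone_isColimit (X : Type u) [DiffeologicalSpace X] :
    (plotCocone k X).IsColimit := by
  intro Y _ g hg hcomm
  let pt (x : X) : PlotCat X := ⟨0, ⊤, fun _ => x, fun _ _ _ => isPlot_const⟩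
  let h (x : X) : Y := g (pt x) (⟨⟨0, trivial⟩⟩ : ULift.{u} (pt x).dom)
  have hh : ∀ (p : PlotCat X) (a : ULift.{u} p.dom), h (p.toFun a.down) = g p a := by
    intro p a
    let f : pt (p.toFun a.down) ⟶ p :=
      { toFun := fun _ => a.down
        smooth := fun x => by
          have : openExt (fun _ : (pt (p.toFun a.down)).dom => a.down) = fun _ => (a.down : Euc _) :=
            funext fun y => openExt_apply _ (⟨y, trivial⟩ : (pt (p.toFun a.down)).dom)
          rw [this]
          exact contDiffAt_const
        comm := fun _ => rfl }
    exact (hcomm f (⟨⟨0, trivial⟩⟩ : ULift.{u} (pt _).dom)).symm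
  refine ⟨h, ⟨fun n P hP => ?_, hh⟩, fun h' hh' => funext fun x => ?_⟩
  · let p : PlotCat X := ⟨n, ⊤, fun x => P x, fun m a ha => isPlot_reparam hP (IsPlot.contDiff ha)⟩
    have := hg p n (fun z => (⟨⟨z, trivial⟩⟩ : ULift.{u} p.dom)) (isPlot_id (n := n))
    refine (congrArg IsPlot (funext fun z => ?_)).mp this
    exact (hh p (⟨⟨z, trivial⟩⟩ : ULift.{u} p.dom)).symm
  · exact hh'.2 (pt x) (⟨⟨0, trivial⟩⟩ : ULift.{u} (pt x).dom)

/-- The bundle `T^k X → X`, the colimit of the bundles `⋀ᵏ TU → U`. -/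
def Tk (X : Type u) [DiffeologicalSpace X] : DVPB.{u} := colimitBundle (plotCocone k X)

/-- The cocone with vertex `T^k X → X` lying over the cocone of plots `U → X`. -/
def tkCocone (X : Type u) [DiffeologicalSpace X] : Limits.Cocone (wedgeTangentFunctor k X) :=
  colimitCocone (plotCocone k X)

/-- `T^k X → X` is the colimit of the bundles `⋀ᵏ TU → U` in the category of diffeological vector
pseudo-bundles. -/
def tkIsColimit (X : Type u) [DiffeologicalSpace X] : Limits.IsColimit (tkCocone k X) :=
  colimitIsColimit _ (plotCocone_isColimit k X)

/-- The element of the fibre of `T^k X` at `p x` represented by `v₁ ∧ ⋯ ∧ v_k ∈ ⋀ᵏ T_x U`. -/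
def tkWedge (p : PlotCat X) (x : p.dom) (v : Fin k → Euc p.dim) : (Tk k X).fibre (p.toFun x) :=
  DVPB.Hom.fib ((tkCocone k X).ι.app p) (⟨x⟩ : ULift.{u} p.dom)
    (exteriorPower.ιMulti ℝ k (M := ULift.{u} (Euc p.dim)) fun i => ⟨v i⟩)

/-- Composition with a smooth map `f : X → Y`, as a functor on plot categories. -/
def plotPush (f : X → Y) (hf : DSmooth f) : PlotCat X ⥤ PlotCat Y where
  obj p := ⟨p.dim, p.dom, f ∘ p.toFun, hf.comp p.smooth⟩
  map g := ⟨g.toFun, g.smooth, fun x => congrArg f (g.comm x)⟩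

/-- The cocone inducing `T^k f`: a plot `p` of `X` is sent to the canonical map for `f ∘ p`. -/
def tkPushCocone (f : X → Y) (hf : DSmooth f) : Limits.Cocone (wedgeTangentFunctor k X) :=
  (tkCocone k Y).whisker (plotPush f hf)

/-- The bundle map `T^k f : T^k X → T^k Y` over `f`. -/
def tkMap (f : X → Y) (hf : DSmooth f) : Tk k X ⟶ Tk k Y :=
  colimitDesc (plotCocone k X) (tkPushCocone k f hf) f hf fun _ _ => rfl

end Tk

/-! ### Differential forms -/

section Forms

variable (k : ℕ)

/-- The standard diffeology on the finite-dimensional space of alternating `k`-linear forms on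
`ℝⁿ`: a map is a plot if all its evaluations (equivalently, its coefficients) are smooth. -/
instance alternatingDiffeology (n : ℕ) : DiffeologicalSpace ((Euc n) [⋀^Fin k]→ₗ[ℝ] ℝ) :=
  ⨅ v : Fin k → Euc n, induced inferInstance (fun η : (Euc n) [⋀^Fin k]→ₗ[ℝ] ℝ => η v)

theorem isPlot_alternating_iff {n m : ℕ} {P : Euc m → (Euc n) [⋀^Fin k]→ₗ[ℝ] ℝ} :
    IsPlot P ↔ ∀ v, ContDiff ℝ ∞ (fun z => P z v) :=
  DiffeologicalSpace.isPlot_iInf_iff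

instance (n : ℕ) : IsDiffeologicalVectorSpace ((Euc n) [⋀^Fin k]→ₗ[ℝ] ℝ) where
  smooth_add hv hw := (isPlot_alternating_iff k).2 fun x =>
    ((isPlot_alternating_iff k).1 hv x).add ((isPlot_alternating_iff k).1 hw x)
  smooth_smul hr hv := (isPlot_alternating_iff k).2 fun x =>
    hr.mul ((isPlot_alternating_iff k).1 hv x)

/-- The subspace of smooth maps from an open subset `U` of `ℝⁿ` to the alternating forms. -/
def formsOn {n : ℕ} (U : Opens (Euc n)) : Submodule ℝ (U → (Euc n) [⋀^Fin k]→ₗ[ℝ] ℝ) where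
  carrier := {η | DSmooth η}
  zero_mem' := dSmooth_const (y := 0)
  add_mem' hs ht := fun n p hp => IsDiffeologicalVectorSpace.smooth_add (hs n p hp) (ht n p hp)
  smul_mem' c _ hs := fun n p hp => IsDiffeologicalVectorSpace.smooth_smul (r := fun _ => c)
    contDiff_const (hs n p hp)

/-- The vector space `Ω^k(U)` of smooth differential `k`-forms on an open subset of `ℝⁿ`. -/
def Form {n : ℕ} (U : Opens (Euc n)) : Type := formsOn k U

instance {n : ℕ} (U : Opens (Euc n)) : AddCommGroup (Form k U) :=
  inferInstanceAs (AddCommGroup (formsOn k U))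

instance {n : ℕ} (U : Opens (Euc n)) : Module ℝ (Form k U) :=
  inferInstanceAs (Module ℝ (formsOn k U))

/-- The functional diffeology on `Ω^k(U)`. -/
instance formDiffeology {n : ℕ} (U : Opens (Euc n)) : DiffeologicalSpace (Form k U) :=
  induced (functionalDiffeology _ _)
    (fun η => (⟨η.1, η.2⟩ : SmoothMap U ((Euc n) [⋀^Fin k]→ₗ[ℝ] ℝ)))

/-- The vector space `Ω^k(X)` of differential `k`-forms on a diffeological space `X`: the limit of
`Ω^k(U)` over the plots `U → X`, that is, the families of forms `η_p` with `η_p = f^* η_q` for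
every morphism of plots `f : p ⟶ q`. -/
def Omega (X : Type u) [DiffeologicalSpace X] :
    Submodule ℝ (∀ p : PlotCat X, Form k p.dom) where
  carrier := {η | ∀ (p q : PlotCat X) (f : p ⟶ q) (x : p.dom),
    (η p).1 x = ((η q).1 (f.toFun x)).compLinearMap (openDeriv f.toFun x).toLinearMap}
  zero_mem' := fun _ _ _ _ => rfl
  add_mem' hs ht := fun p q f x =>
    (congrArg₂ (· + ·) (hs p q f x) (ht p q f x)).trans rfl
  smul_mem' c _ hs := fun p q f x => (congrArg (c • ·) (hs p q f x)).trans rfl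

/-- The limit diffeology on `Ω^k(X)`: a map is a plot if all its components are. -/
instance omegaDiffeology (X : Type u) [DiffeologicalSpace X] : DiffeologicalSpace (Omega k X) :=
  ⨅ p : PlotCat X, induced inferInstance (fun η : Omega k X => η.1 p)

instance (X : Type u) [DiffeologicalSpace X] : IsDiffeologicalVectorSpace (Omega k X) where
  smooth_add hv hw := DiffeologicalSpace.isPlot_iInf_iff.2 fun p _ g x hg hx =>
    IsDiffeologicalVectorSpace.smooth_add (DiffeologicalSpace.isPlot_iInf_iff.1 hv p g x hg hx)
      (DiffeologicalSpace.isPlot_iInf_iff.1 hw p g x hg hx)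
  smooth_smul hr hv := DiffeologicalSpace.isPlot_iInf_iff.2 fun p _ g x hg hx =>
    IsDiffeologicalVectorSpace.smooth_smul (hr.comp hg)
      (DiffeologicalSpace.isPlot_iInf_iff.1 hv p g x hg hx)

/-- The pullback of forms along a smooth map `f : X → Y`, `(f^* η)_p = η_{f ∘ p}`. -/
def omegaPull {X Y : Type u} [DiffeologicalSpace X] [DiffeologicalSpace Y] (f : X → Y)
    (hf : DSmooth f) (η : Omega k Y) : Omega k X :=
  ⟨fun p => η.1 ((plotPush f hf).obj p), fun _ _ g x => η.2 _ _ ((plotPush f hf).map g) x⟩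

end Forms

end

end DForm

open DForm

namespace DForm

noncomputable section

/-! A section of the dual of `Tk k X` assigns a linear functional to each fibre. Such a fibre is a
direct sum of exterior powers of tangent spaces of plots, modulo the relations given by morphisms of
plots. A functional on it is thus a compatible family of functionals on the summands, that is, of
alternating forms on the tangent spaces, and the colimit relations turn into exactly the condition
`η_p = f^* η_q`. Algebraically the two sides agree; both composites are checked on wedges of tangent
vectors, which span the fibres.

What remains is smoothness, for plots of sections and of forms. From sections to forms it suffices
to pair with wedges of constant vector fields (`isPlot_tkWedge`), since the coefficients of a form
are such pairings.

From forms to sections one must show that a family of functionals, depending on a parameter `w`, is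
jointly smooth on a total space whose diffeology is produced by dvsification, applied both in the
exterior power and in the colimit. No description of the plots of a dvsification is needed. The
lifts on which the family is jointly smooth form a diffeology, and linearity makes it a
pseudo-bundle diffeology. By minimality it contains the dvsification as soon as it contains the
generating plots (`contDiff_functional_dvsification`). This gives `isSmoothFamily_exteriorPower` and
`isSmoothFamily_colimit`. The parameter is carried throughout, so a single form is just the case of
a constant family. -/

/-! ### Families of fibrewise linear functionals -/

section Functional

variable {B : Type*} [DiffeologicalSpace B] {F : B → Type*}
  [∀ b, AddCommGroup (F b)] [∀ b, Module ℝ (F b)]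

/-- The largest diffeology on the total space `Σ b, F b` with smooth projection for which the family
of fibrewise linear functionals `l w`, `w ∈ ℝⁿ`, is jointly smooth on `ℝⁿ × Σ b, F b`. -/
@[reducible] def functionalFamilyDiffeology {n : ℕ} (l : Euc n → ∀ b, F b →ₗ[ℝ] ℝ)
    (hl : ∀ b v, ContDiff ℝ ∞ fun w => l w b v) : DiffeologicalSpace (Σ b, F b) where
  -- The parameter `g` and the reparametrization `h` vary independently over a common `ℝʳ`, so this
  -- expresses smoothness on the product and is stable under precomposition.
  plots m := {y | IsPlot (fun z => (y z).1) ∧ ∀ ⦃r : ℕ⦄ (g : Euc r → Euc n) (h : Euc r → Euc m),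
    ContDiff ℝ ∞ g → ContDiff ℝ ∞ h → ContDiff ℝ ∞ (fun z => l (g z) (y (h z)).1 (y (h z)).2)}
  -- Constants are plots only if the family is smooth in `w` at each fixed vector, which is what
  -- `hl` provides.
  constant_plots y := ⟨isPlot_const, fun _ _ _ hg _ => (hl y.1 y.2).comp hg⟩
  plot_reparam hp hf := ⟨isPlot_reparam hp.1 hf, fun _ g h hg hh => hp.2 g (_ ∘ h) hg (hf.comp hh)⟩
  locality {m y} hy := by
    refine ⟨DiffeologicalSpace.locality fun z => ?_, fun r g h hg hh => IsPlot.contDiff ?_⟩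
    · obtain ⟨s, hs, hzs, H⟩ := hy z
      exact ⟨s, hs, hzs, fun {l f} hf hf' => (H hf hf').1⟩
    · refine DiffeologicalSpace.locality fun z => ?_
      obtain ⟨s, hs, hzs, H⟩ := hy (h z)
      refine ⟨h ⁻¹' s, hs.preimage hh.continuous, hzs, fun {l f} hf hf' => ContDiff.isPlot ?_⟩
      exact (H (f := h ∘ f) hf (hh.comp hf')).2 (g ∘ f) id (hg.comp hf') contDiff_id

/-- Fibrewise linearity of `l` reduces the bundle operations to addition and multiplication of
smooth real functions. -/
theorem isPseudoBundle_functionalFamily {n : ℕ} (l : Euc n → ∀ b, F b →ₗ[ℝ] ℝ)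
    (hl : ∀ b v, ContDiff ℝ ∞ fun w => l w b v) :
    IsPseudoBundle (functionalFamilyDiffeology l hl) where
  smooth_proj _ _ hp := hp.1
  smooth_add hv hw := ⟨hv.1, fun _ g h hg hh => by
    simpa only [map_add] using (hv.2 g h hg hh).add (hw.2 g h hg hh)⟩
  smooth_smul hr hv := ⟨hv.1, fun _ g h hg hh => by
    simp only [map_smul, smul_eq_mul]
    exact (hr.comp hh).mul (hv.2 g h hg hh)⟩
  smooth_zero _ _ hp := ⟨hp, fun _ _ _ _ _ => by
    simpa only [Function.comp_apply, map_zero] using contDiff_const⟩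

/-- A family of fibrewise linear functionals which is jointly smooth before dvsification is jointly
smooth. -/
theorem contDiff_functional_dvsification {n : ℕ} (l : Euc n → ∀ b, F b →ₗ[ℝ] ℝ)
    (hl : ∀ b v, ContDiff ℝ ∞ fun w => l w b v) (d₀ : DiffeologicalSpace (Σ b, F b))
    (h₀ : d₀ ≤ functionalFamilyDiffeology l hl) {m r : ℕ} {y : Euc m → Σ b, F b}
    (hy : @IsPlot _ (dvsification d₀) _ y) {g : Euc r → Euc n} {h : Euc r → Euc m}
    (hg : ContDiff ℝ ∞ g) (hh : ContDiff ℝ ∞ h) :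
    ContDiff ℝ ∞ (fun z => l (g z) (y (h z)).1 (y (h z)).2) :=
  -- The dvsification is the infimum of the pseudo-bundle diffeologies above `d₀`, and the
  -- functional family diffeology is one of them.
  (DiffeologicalSpace.isPlot_sInf_iff.1 hy _ ⟨h₀, isPseudoBundle_functionalFamily l hl⟩).2
    g h hg hh

end Functional

/-! ### Smooth families of functionals on exterior powers -/

/-- Joint smoothness on `ℝⁿ × E` of a family of fibrewise linear functionals on a pseudo-bundle. -/
def DVPB.IsSmoothFamily (E : DVPB.{u}) {n : ℕ} (l : Euc n → ∀ b, E.fibre b →ₗ[ℝ] ℝ) : Prop :=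
  ∀ ⦃m : ℕ⦄ (g : Euc m → Euc n) (y : Euc m → E.Total), ContDiff ℝ ∞ g → IsPlot y →
    ContDiff ℝ ∞ fun z => l (g z) (y z).1 (y z).2

theorem DVPB.IsSmoothFamily.contDiff {E : DVPB.{u}} {n : ℕ} {l : Euc n → ∀ b, E.fibre b →ₗ[ℝ] ℝ}
    (hl : E.IsSmoothFamily l) (b : E.base) (v : E.fibre b) : ContDiff ℝ ∞ fun w => l w b v :=
  hl id (fun _ => ⟨b, v⟩) contDiff_id isPlot_const

/-- Smooth families of fibrewise alternating forms give smooth families of functionals on the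
exterior power bundle. -/
theorem isSmoothFamily_exteriorPower (k : ℕ) (E : DVPB.{u}) {n : ℕ}
    (l : Euc n → ∀ b, E.fibre b [⋀^Fin k]→ₗ[ℝ] ℝ)
    (H : ∀ ⦃m : ℕ⦄ (g : Euc m → Euc n) (q : Euc m → E.base) (v : ∀ z, Fin k → E.fibre (q z)),
      ContDiff ℝ ∞ g → IsPlot q → (∀ i, IsPlot fun z => (⟨q z, v z i⟩ : E.Total)) →
        ContDiff ℝ ∞ fun z => l (g z) (q z) (v z)) :
    (E.exteriorPower k).IsSmoothFamily
      fun w (b : E.base) => exteriorPower.alternatingMapLinearEquiv (l w b) := by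
  intro m g y hg hy
  refine contDiff_functional_dvsification
    (fun w (b : E.base) => exteriorPower.alternatingMapLinearEquiv (l w b)) (fun b v => ?_)
    (wedgeDiffeology k E) ?_ hy hg contDiff_id
  -- Smoothness in the parameter at a fixed multivector: decomposables span, and on them it is `H`
  -- along constant plots.
  · have hv : v ∈ Submodule.span ℝ (Set.range (exteriorPower.ιMulti ℝ k (M := E.fibre b))) := by
      rw [exteriorPower.ιMulti_span]; trivial
    induction hv using Submodule.span_induction with
    | mem v hv =>
      obtain ⟨v, rfl⟩ := hv
      simp only [exteriorPower.alternatingMapLinearEquiv_apply_ιMulti]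
      exact H id (fun _ => b) (fun _ => v) contDiff_id isPlot_const fun _ => isPlot_const
    | zero => simpa only [map_zero] using contDiff_const
    | add v w _ _ hv hw => simpa only [map_add] using hv.add hw
    | smul r v _ hv => simpa only [map_smul] using hv.const_smul r
  -- On a generating plot the functional is the alternating form evaluated on plots of `E`, so `H`
  -- applies directly.
  · rw [DiffeologicalSpace.generateFrom_le_iff]
    rintro _ _ ⟨m, q, v, hq, hv, h⟩
    cases h
    refine ⟨hq, fun r g h hg hh => ?_⟩
    simp only [exteriorPower.alternatingMapLinearEquiv_apply_ιMulti]
    exact H g (q ∘ h) (fun z => v (h z)) hg (isPlot_reparam hq hh) fun i =>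
      isPlot_reparam (hv i) hh

/-! ### Functionals on colimits of pseudo-bundles -/

section ColimitFunctional

variable {J : Type u} [Category.{0} J] {F : J ⥤ DVPB.{u}} {B : Type u} [DiffeologicalSpace B]
  (c : BaseCocone F B)

open Classical in
/-- The functionals on the fibres of the colimit given by a compatible family of functionals. -/
def colimitFunctional (l : ∀ j a, (F.obj j).fibre a →ₗ[ℝ] ℝ)
    (hl : ∀ {i j : J} (f : i ⟶ j) a v, l j _ ((F.map f).fib a v) = l i a v) (b : B) :
    ColimitFibre c b →ₗ[ℝ] ℝ :=
  (colimitRelations c b).liftQ (DirectSum.toModule ℝ _ _ fun a => l a.idx a.pt) (by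
    rw [colimitRelations, Submodule.span_le]
    rintro _ ⟨p, q, f, a, hb, v, rfl⟩
    simp only [SetLike.mem_coe, LinearMap.mem_ker, map_sub, DirectSum.toModule_lof, sub_eq_zero]
    exact hl f a v)

theorem colimitFunctional_toColimitFibre (l : ∀ j a, (F.obj j).fibre a →ₗ[ℝ] ℝ)
    (hl : ∀ {i j : J} (f : i ⟶ j) a v, l j _ ((F.map f).fib a v) = l i a v) {b : B}
    (a : PointOver c b) (v : fibreOver c a) :
    colimitFunctional c l hl b (toColimitFibre c a v) = l a.idx a.pt v := by
  simp only [colimitFunctional, toColimitFibre, LinearMap.comp_apply, Submodule.mkQ_apply,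
    Submodule.liftQ_apply, DirectSum.toModule_lof]

/-- The fibre is a quotient of a direct sum, so every element is a finite sum of images of vectors
of the diagram. No scalar case is needed, because those images are already closed under scaling. -/
theorem colimitFibre_induction {b : B} {Q : ColimitFibre c b → Prop} (h0 : Q 0)
    (hadd : ∀ e e', Q e → Q e' → Q (e + e')) (h : ∀ a v, Q (toColimitFibre c a v)) (e) : Q e := by
  classical
  obtain ⟨e, rfl⟩ := Submodule.mkQ_surjective _ e
  induction e using DirectSum.induction_on with
  | zero => simpa only [map_zero] using h0
  | of a v => exact h a v
  | add e e' he he' => simpa only [map_add] using hadd _ _ he he'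

/-- Compatible smooth families of functionals on the objects of a diagram give a smooth family of
functionals on the colimit. -/
theorem isSmoothFamily_colimit {n : ℕ} (l : Euc n → ∀ j a, (F.obj j).fibre a →ₗ[ℝ] ℝ)
    (hl : ∀ w {i j : J} (f : i ⟶ j) a v, l w j _ ((F.map f).fib a v) = l w i a v)
    (H : ∀ j, (F.obj j).IsSmoothFamily fun w => l w j) :
    (colimitBundle c).IsSmoothFamily fun w => colimitFunctional c (l w) (hl w) := by
  intro m g y hg hy
  refine contDiff_functional_dvsification (fun w => colimitFunctional c (l w) (hl w))
    (fun b e => ?_) (colimitPreDiffeology c) ?_ hy hg contDiff_id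
  · induction e using colimitFibre_induction with
    | h0 => simpa only [map_zero] using contDiff_const
    | hadd e e' he he' => simpa only [map_add] using he.add he'
    | h a v =>
      simpa only [colimitFunctional_toColimitFibre] using (H a.idx).contDiff a.pt v
  · rw [DiffeologicalSpace.generateFrom_le_iff]
    rintro _ _ ⟨m, p, q, hq, h⟩
    cases h
    refine ⟨c.smooth p _ _ ((F.obj p).isPseudoBundle.smooth_proj _ _ hq),
      fun r g h hg hh => ?_⟩
    exact (congrArg (ContDiff ℝ ∞) (funext fun z => colimitFunctional_toColimitFibre c (l (g z))
      (hl (g z)) ⟨p, (q (h z)).1, rfl⟩ (q (h z)).2)).mpr (H p g (q ∘ h) hg (isPlot_reparam hq hh))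

end ColimitFunctional

/-! ### Evaluation of smooth families of forms -/

/-- The diffeology on forms only controls evaluation at fixed vectors. Expanding each `v z i` in the
standard basis writes the value as a finite sum of products of smooth coordinates with evaluations
at fixed basis vectors. -/
theorem contDiff_alternating_apply (k : ℕ) {n m : ℕ} {η : Euc m → (Euc n) [⋀^Fin k]→ₗ[ℝ] ℝ}
    (hη : IsPlot η) {v : Euc m → Fin k → Euc n} (hv : ∀ i, ContDiff ℝ ∞ fun z => v z i) :
    ContDiff ℝ ∞ (fun z => η z (v z)) := by
  have key : (fun z => η z (v z)) = fun z => ∑ r : Fin k → Fin n,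
      (∏ i, v z i (r i)) * η z (fun i => EuclideanSpace.basisFun (Fin n) ℝ (r i)) := by
    funext z
    have hz : v z = fun i => ∑ j, v z i j • EuclideanSpace.basisFun (Fin n) ℝ j := by
      funext i
      simpa using ((EuclideanSpace.basisFun (Fin n) ℝ).sum_repr (v z i)).symm
    conv_lhs => rw [hz]
    rw [← AlternatingMap.coe_multilinearMap, MultilinearMap.map_sum]
    simp only [MultilinearMap.map_smul_univ, smul_eq_mul]
  rw [key]
  refine ContDiff.sum fun r _ => ContDiff.mul (contDiff_prod fun i _ => ?_)
    ((isPlot_alternating_iff k).1 hη _)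
  exact contDiff_euclidean.1 (hv i) (r i)

section Iso

variable (k : ℕ) {X : Type u} [DiffeologicalSpace X]

/-- Plots of `Ω^k(X)` give smooth families of forms on the domains of plots of `X`. -/
theorem isPlot_omega_apply {n m : ℕ} {P : Euc n → Omega k X} (hP : IsPlot P) (p : PlotCat X)
    {g : Euc m → Euc n} (hg : ContDiff ℝ ∞ g) {x : Euc m → p.dom} (hx : IsPlot x) :
    IsPlot (fun z => ((P (g z)).1 p).1 (x z)) :=
  DiffeologicalSpace.isPlot_iInf_iff.1 hP p g x hg hx

/-! ### Wedges of tangent vectors as generators of the fibres -/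

/-- The element `v₁ ∧ ⋯ ∧ v_k ∈ ⋀ᵏ T_x U`. -/
def wedgeVector (p : PlotCat X) (a : ((wedgeTangentFunctor k X).obj p).base) :
    (Euc p.dim) [⋀^Fin k]→ₗ[ℝ] ((wedgeTangentFunctor k X).obj p).fibre a :=
  (exteriorPower.ιMulti ℝ k (M := ULift.{u} (Euc p.dim))).compLinearMap
    ULift.moduleEquiv.symm.toLinearMap

theorem map_wedgeVector {p q : PlotCat X} (f : p ⟶ q)
    (a : ((wedgeTangentFunctor k X).obj p).base) (v : Fin k → Euc p.dim) :
    ((wedgeTangentFunctor k X).map f).fib a (wedgeVector k p a v) =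
      wedgeVector k q _ fun i => openDeriv f.toFun a.down (v i) :=
  exteriorPower.map_apply_ιMulti (R := ℝ) (M := ULift.{u} (Euc p.dim)) (N := ULift.{u} (Euc q.dim))
    ((tangentMap f).fib a) _

theorem wedgeFibre_linearMap_ext {p : PlotCat X} {a : ((wedgeTangentFunctor k X).obj p).base}
    {φ ψ : ((wedgeTangentFunctor k X).obj p).fibre a →ₗ[ℝ] ℝ}
    (h : ∀ v, φ (wedgeVector k p a v) = ψ (wedgeVector k p a v)) : φ = ψ :=
  exteriorPower.linearMap_ext (R := ℝ) (M := ULift.{u} (Euc p.dim)) (n := k)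
    (AlternatingMap.ext fun v => h fun i => (v i).down)

/-- The fibre of `T^k X` is spanned by the wedge products of tangent vectors of plots. -/
theorem tkFibre_linearMap_ext {b : X} {φ ψ : ColimitFibre (plotCocone k X) b →ₗ[ℝ] ℝ}
    (h : ∀ (a : PointOver (plotCocone k X) b) (v : Fin k → Euc a.idx.dim),
      φ (toColimitFibre (plotCocone k X) a (wedgeVector k a.idx a.pt v)) =
        ψ (toColimitFibre (plotCocone k X) a (wedgeVector k a.idx a.pt v))) : φ = ψ := by
  classical
  refine Submodule.linearMap_qext _ (DirectSum.linearMap_ext _ fun a => ?_)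
  exact wedgeFibre_linearMap_ext k (h a)

/-! ### From forms to sections -/

/-- The linear functional on `⋀ᵏ T_x U` given by a form. -/
def formFunctional (η : Omega k X) (p : PlotCat X) (a : ((wedgeTangentFunctor k X).obj p).base) :
    ((wedgeTangentFunctor k X).obj p).fibre a →ₗ[ℝ] ℝ :=
  exteriorPower.alternatingMapLinearEquiv (M := ULift.{u} (Euc p.dim))
    (((η.1 p).1 a.down).compLinearMap ULift.moduleEquiv.toLinearMap)

theorem formFunctional_wedgeVector (η : Omega k X) (p : PlotCat X)
    (a : ((wedgeTangentFunctor k X).obj p).base) (v : Fin k → Euc p.dim) :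
    formFunctional k η p a (wedgeVector k p a v) = (η.1 p).1 a.down v :=
  exteriorPower.alternatingMapLinearEquiv_apply_ιMulti (M := ULift.{u} (Euc p.dim)) _ _

/-- On decomposables this is the compatibility `η_p = f^* η_q`; it is what lets the functionals
descend to the colimit. -/
theorem formFunctional_map (η : Omega k X) {p q : PlotCat X} (f : p ⟶ q)
    (a : ((wedgeTangentFunctor k X).obj p).base)
    (v : ((wedgeTangentFunctor k X).obj p).fibre a) :
    formFunctional k η q _ (((wedgeTangentFunctor k X).map f).fib a v) =
      formFunctional k η p a v := by
  have h : (formFunctional k η q _).comp (((wedgeTangentFunctor k X).map f).fib a) =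
      formFunctional k η p a := by
    refine wedgeFibre_linearMap_ext k fun v => ?_
    rw [LinearMap.comp_apply, map_wedgeVector, formFunctional_wedgeVector,
      formFunctional_wedgeVector, η.2 p q f a.down]
    rfl
  exact LinearMap.congr_fun h v

/-- The linear functional on the fibre of `T^k X` given by a form. -/
def tkFunctional (η : Omega k X) (b : X) : ColimitFibre (plotCocone k X) b →ₗ[ℝ] ℝ :=
  colimitFunctional (plotCocone k X) (formFunctional k η) (formFunctional_map k η) b

theorem tkFunctional_wedgeVector (η : Omega k X) {b : X} (a : PointOver (plotCocone k X) b)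
    (v : Fin k → Euc a.idx.dim) :
    tkFunctional k η b (toColimitFibre _ a (wedgeVector k a.idx a.pt v)) =
      (η.1 a.idx).1 a.pt.down v :=
  (colimitFunctional_toColimitFibre (plotCocone k X) _ (formFunctional_map k η) a _).trans
    (formFunctional_wedgeVector k η _ _ v)

theorem isSmoothFamily_formFunctional {n : ℕ} {P : Euc n → Omega k X} (hP : IsPlot P)
    (p : PlotCat X) :
    ((wedgeTangentFunctor k X).obj p).IsSmoothFamily fun w => formFunctional k (P w) p := by
  refine isSmoothFamily_exteriorPower k (tangentBundle p)
    (fun w (a : ULift.{u} p.dom) => AlternatingMap.compLinearMap (M₂ := ULift.{u} (Euc p.dim))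
      (((P w).1 p).1 a.down) ULift.moduleEquiv.toLinearMap) fun m g q v hg hq hv => ?_
  refine contDiff_alternating_apply k (isPlot_omega_apply k hP p hg hq) fun i => ?_
  exact IsPlot.contDiff (X := Euc p.dim) (DiffeologicalSpace.isPlot_inf_iff.1 (hv i)).2

/-- A smooth family of forms defines a smooth family of functionals on `T^k X`. -/
theorem isSmoothFamily_tkFunctional {n : ℕ} {P : Euc n → Omega k X} (hP : IsPlot P) :
    (Tk k X).IsSmoothFamily fun w => tkFunctional k (P w) :=
  isSmoothFamily_colimit (plotCocone k X) (fun w => formFunctional k (P w))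
    (fun w => formFunctional_map k (P w)) (isSmoothFamily_formFunctional k hP)

/-- The section of the dual of `T^k X` given by a form. -/
def omegaToSection (η : Omega k X) : (Tk k X).dual.sections :=
  -- One form is a plot with parameter space `ℝ⁰`; the parameter map is then the constant `0`.
  have h := isSmoothFamily_tkFunctional k (isPlot_const (n := 0) (x := η))
  ⟨fun b => ⟨tkFunctional k η b, fun _ _ hy => (h _ _ (contDiff_const (c := 0)) hy).isPlot⟩,
    fun _ _ hp => ⟨hp, fun _ _ _ _ hx => h _ _ (contDiff_const (c := 0)) hx⟩⟩

theorem dSmooth_omegaToSection : DSmooth (omegaToSection k (X := X)) :=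
  fun _ _ hP _ _ _ hg hx => ⟨hx, fun _ _ _ hh hy =>
    isSmoothFamily_tkFunctional k hP _ _ (hg.comp hh) hy⟩

/-! ### From sections to forms -/

/-- Constant vectors along `x` are plots of `TU`, so their wedge is a generating plot of the
exterior power, and the canonical map to the colimit is smooth. These are the test plots that
extract the coefficients of a form from a section. -/
theorem isPlot_tkWedge (p : PlotCat X) (v : Fin k → Euc p.dim) {m : ℕ} {x : Euc m → p.dom}
    (hx : IsPlot x) :
    IsPlot (fun z => (⟨p.toFun (x z), tkWedge k p (x z) v⟩ : (Tk k X).Total)) := by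
  refine (colimitLeg (plotCocone k X) p).smooth_total m
    (fun z => ⟨⟨x z⟩, wedgeVector k p ⟨x z⟩ v⟩) ?_
  refine DiffeologicalSpace.le_iff'.1 (le_dvsification (wedgeDiffeology k (tangentBundle p))) _ _
    (DiffeologicalSpace.isPlot_generatedFrom_of_mem
      ⟨m, fun z => (⟨x z⟩ : ULift.{u} p.dom), fun _ i => (⟨v i⟩ : ULift.{u} (Euc p.dim)), hx,
        fun i => ?_, rfl⟩)
  exact DiffeologicalSpace.isPlot_inf_iff.2 ⟨hx, isPlot_const (X := Euc p.dim) (x := v i)⟩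

/-- This is the cocone identity for `f` on a decomposable. It is stated in the total space because
the base points `q (f x)` and `p x` agree only through `f.comm`. -/
theorem tkWedge_map {p q : PlotCat X} (f : p ⟶ q) (x : p.dom) (v : Fin k → Euc p.dim) :
    (⟨q.toFun (f.toFun x), tkWedge k q (f.toFun x) fun i => openDeriv f.toFun x (v i)⟩ :
      (Tk k X).Total) = ⟨p.toFun x, tkWedge k p x v⟩ := by
  refine Eq.trans ?_ (congrArg (fun g => DVPB.Hom.total g
    (⟨⟨x⟩, wedgeVector k p ⟨x⟩ v⟩ : ((wedgeTangentFunctor k X).obj p).Total))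
    ((tkCocone k X).w f))
  exact congrArg (fun w => DVPB.Hom.total ((tkCocone k X).ι.app q)
    (⟨⟨f.toFun x⟩, w⟩ : ((wedgeTangentFunctor k X).obj q).Total))
    (map_wedgeVector k f ⟨x⟩ v).symm

/-- The alternating form on `T_x U` given by a section of the dual of `T^k X`. -/
def sectionForm (s : (Tk k X).dual.sections) (p : PlotCat X) (x : p.dom) :
    (Euc p.dim) [⋀^Fin k]→ₗ[ℝ] ℝ :=
  LinearMap.compAlternatingMap (LinearMap.comp
    (M₂ := ColimitFibre (plotCocone k X) (p.toFun x)) (s.1 (p.toFun x)).1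
    (toColimitFibre (plotCocone k X) ⟨p, ⟨x⟩, rfl⟩)) (wedgeVector k p ⟨x⟩)

/-- A plot of forms is detected on fixed vectors `v`. There the value is the pairing of a plot of
the dual bundle with the plot `tkWedge k p (x z) v` over the same base map, which is smooth by
definition of the dual diffeology. -/
theorem isPlot_sectionForm {n m : ℕ} {P : Euc n → (Tk k X).dual.sections} (hP : IsPlot P)
    (p : PlotCat X) {g : Euc m → Euc n} (hg : ContDiff ℝ ∞ g) {x : Euc m → p.dom}
    (hx : IsPlot x) : IsPlot (fun z => sectionForm k (P (g z)) p (x z)) :=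
  (isPlot_alternating_iff k).2 fun v =>
    (hP g (fun z => p.toFun (x z)) hg (p.smooth _ _ hx)).2 id
      (fun z => tkWedge k p (x z) v) contDiff_id (isPlot_tkWedge k p v hx)

/-- The differential form given by a section of the dual of `T^k X`. -/
def sectionToOmega (s : (Tk k X).dual.sections) : Omega k X :=
  ⟨fun p => ⟨sectionForm k s p, fun _ _ hx => isPlot_sectionForm k
      (isPlot_const (n := 0) (x := s)) p (contDiff_const (c := 0)) hx⟩,
    fun _ _ f x => AlternatingMap.ext fun v =>
      -- Pairing with `s` is a function on the whole total space, so it can be applied to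
      -- `tkWedge_map` without transport between fibres.
      (congrArg (fun y : (Tk k X).Total => (s.1 y.1).1 y.2) (tkWedge_map k f x v)).symm⟩

theorem dSmooth_sectionToOmega : DSmooth (sectionToOmega k (X := X)) := fun _ _ hP =>
  DiffeologicalSpace.isPlot_iInf_iff.2 fun p _ _ _ hg hx => isPlot_sectionForm k hP p hg hx

/-! ### The isomorphism -/

theorem omegaToSection_sectionToOmega (s : (Tk k X).dual.sections) :
    omegaToSection k (sectionToOmega k s) = s := by
  refine Subtype.ext (funext fun b => Subtype.ext (tkFibre_linearMap_ext k ?_))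
  -- Eliminating the equation `p x = b` makes the point over `b` the one used in `sectionForm`, so
  -- both sides match definitionally.
  rintro ⟨p, ⟨x⟩, rfl⟩ v
  exact tkFunctional_wedgeVector k (sectionToOmega k s) ⟨p, ⟨x⟩, rfl⟩ v

theorem sectionToOmega_omegaToSection (η : Omega k X) :
    sectionToOmega k (omegaToSection k η) = η :=
  Subtype.ext (funext fun p => Subtype.ext (funext fun x => AlternatingMap.ext fun v =>
    tkFunctional_wedgeVector k η ⟨p, ⟨x⟩, rfl⟩ v))

variable (X) in
/-- Sections of the dual of `T^k X` are the differential `k`-forms on `X`. -/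
def sectionsEquivOmega : DVSEquiv (Tk k X).dual.sections (Omega k X) where
  toEquiv :=
    { toFun := sectionToOmega k
      map_add' := fun _ _ => rfl
      map_smul' := fun _ _ => rfl
      invFun := omegaToSection k
      left_inv := omegaToSection_sectionToOmega k
      right_inv := sectionToOmega_omegaToSection k }
  smooth_toFun := dSmooth_sectionToOmega k
  smooth_invFun := dSmooth_omegaToSection k

/-! ### Naturality -/

/-- The map `tkMap` is induced by the cocone whose leg at `p` is the canonical map for `f ∘ p`, so
this is the factorization through that leg. Both base points are definitionally `f (p x)`, hence the
heterogeneous equality of fibre vectors is an ordinary one. -/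
theorem tkMap_tkWedge {Y : Type u} [DiffeologicalSpace Y] (f : X → Y) (hf : DSmooth f)
    (p : PlotCat X) (x : p.dom) (v : Fin k → Euc p.dim) :
    (tkMap k f hf).fib (p.toFun x) (tkWedge k p x v) =
      tkWedge k ((plotPush f hf).obj p) x v := by
  have h := colimitDescFib_toColimitFibre (plotCocone k X) (tkPushCocone k f hf) f
    (fun _ _ => rfl) p (⟨⟨x⟩, wedgeVector k p ⟨x⟩ v⟩ : ((wedgeTangentFunctor k X).obj p).Total)
  exact eq_of_heq (Sigma.mk.inj h).2

/-- At `p`, `x`, `v` both sides pair `s (f (p x))` with the class of the same wedge, taken in the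
plot `f ∘ p`. -/
theorem sectionToOmega_pullDual {Y : Type u} [DiffeologicalSpace Y] (f : X → Y) (hf : DSmooth f)
    (s : (Tk k Y).dual.sections) :
    sectionToOmega k (DVPB.pullDual (tkMap k f hf) s) = omegaPull k f hf (sectionToOmega k s) :=
  Subtype.ext (funext fun p => Subtype.ext (funext fun x => AlternatingMap.ext fun v =>
    congrArg (s.1 (f (p.toFun x))).1 (tkMap_tkWedge k f hf p x v)))

end Iso

end

end DForm

open DForm

theorem theorem4p1 (k : ℕ) :
    ∃ Φ : ∀ (X : Type u) [DiffeologicalSpace X], DVSEquiv (Tk k X).dual.sections (Omega k X),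
      (∀ (X Y : Type u) [DiffeologicalSpace X] [DiffeologicalSpace Y] (f : X → Y)
        (hf : DSmooth f) (s : (Tk k Y).dual.sections),
        (Φ X).toEquiv (DVPB.pullDual (tkMap k f hf) s) = omegaPull k f hf ((Φ Y).toEquiv s)) ∧
      (∀ (X : Type u) [DiffeologicalSpace X] (s : (Tk k X).dual.sections) (p : PlotCat X)
        (x : p.dom) (v : Fin k → Euc p.dim),
        (((Φ X).toEquiv s).1 p).1 x v = (s.1 (p.toFun x)).1 (tkWedge k p x v)) :=
  ⟨fun X _ => sectionsEquivOmega k X,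
    fun _ _ _ _ f hf s => sectionToOmega_pullDual k f hf s, fun _ _ _ _ _ _ => rfl⟩
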